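/- Fix integers $N\ge 1$ and $n\ge 0$. A colored permutation $\pi\in C_N\wr S_n$ is a word $\pi=\pi_1\cdots\pi_n$ with letters $\pi_i=|\pi_i|^{\epsilon_i}$, where $|\pi_1|\cdots|\pi_n|$ is a permutation of $\{1,\dots,n\}$ and $\epsilon_i\in\{0,1,\dots,N-1\}$ is the color of the $i$-th letter. Letters are ordered by $$1^{N-1}<\cdots<n^{N-1}<1^{N-2}<\cdots<n^{N-2}<\cdots<1^0<\cdots<n^0 .$$ Let $\mathrm{EXC}(\pi)=\{i\in\{1,\dots,n\}:\pi_i>i^0\}$, $\mathrm{exc}(\pi)=|\mathrm{EXC}(\pi)|$, let $\mathrm{fix}_k(\pi)$ be the number of $i$ with $\pi_i=i^k$ for $0\le k\le N-1$, and let $\mathrm{col}_m(\pi)$ be the number of $i$ with $\epsilon_i=m$ for $1\le m\le N-1$. Let $\widetilde\pi$ be the word obtained from $\pi$ by replacing $\pi_i$ with $\widetilde{\pi_i}$ for every $i\in\mathrm{EXC}(\pi)$, where the letters with a tilde are ordered by $\widetilde{1^0}<\cdots<\widetilde{n^0}$ and are all smaller than every letter without a tilde. Put $\mathrm{DEX}(\pi)=\{i\in\{1,\dots,n-1\}:\widetilde\pi_i>\widetilde\pi_{i+1}\}$.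 For $T\subseteq\{1,\dots,n-1\}$ let $$F_{T,n}=\sum_{\substack{i_1\ge i_2\ge\cdots\ge i_n\ge 1\\ i_j>i_{j+1}\text{ if }j\in T}}x_{i_1}x_{i_2}\cdots x_{i_n}\qquad(F_{\emptyset,0}=1),$$ a formal power series with integer coefficients in commuting variables $x_1,x_2,\dots$. For $j\in\mathbb N$, $\alpha\in\mathbb N^{N}$ and $\beta=(\beta_1,\dots,\beta_{N-1})\in\mathbb N^{N-1}$ define $$Q_{n,j,\alpha,\beta}=\sum_{\pi}F_{\mathrm{DEX}(\pi),n},$$ where the sum is over all $\pi\in C_N\wr S_n$ with $\mathrm{exc}(\pi)=j$, $(\mathrm{fix}_0(\pi),\dots,\mathrm{fix}_{N-1}(\pi))=\alpha$ and $(\mathrm{col}_1(\pi),\dots,\mathrm{col}_{N-1}(\pi))=\beta$. Put $D_{n,\beta}=Q_{n,0,\vec 0,\beta}$. Let $e_k$ and $h_k$ be the elementary and the complete homogeneous symmetric functions of degree $k$ in $x_1,x_2,\dots$. Theorem. Let $\beta\in\mathbb N^{N-1}$ with $\beta_1+\cdots+\beta_{N-1}=n$. Then $$D_{n,\beta}=(-1)^n\prod_{m=1}^{N-1}e_{\beta_m}+\sum_{m=1}^{N-1}\chi(\beta_m>0)\,D_{n-1,\beta(\hat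 m)}\,h_1,$$ where $\beta(\hat m)=(\beta_1,\dots,\beta_{m-1},\beta_m-1,\beta_{m+1},\dots,\beta_{N-1})$, $\chi(P)=1$ if $P$ is true and $\chi(P)=0$ otherwise, and a term with $\beta_m=0$ is read as $0$. -/

import Mathlib

/-!
Colored permutations with `N = M + 1` colors `0, 1, …, M`.  Positions and values `1, …, n` are
represented by `Fin n`, so position `i : Fin n` stands for the integer `i + 1`.  Vectors indexed by
the nonzero colors `1, …, N - 1` are functions on `Fin M`, where `m : Fin M` stands for the color
`m.succ`.
-/

namespace ColoredEulerian

/-- A colored permutation of length `n`: the word whose `i`-th letter is the integer `π.1 i` with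
color `π.2 i`.  The absolute values of the letters form a permutation. -/
abbrev ColoredPerm (M n : ℕ) : Type := Equiv.Perm (Fin n) × (Fin n → Fin (M + 1))

/-- The ordered alphabet of colored integers: a larger color gives a smaller letter, and letters
of the same color are ordered by their value. -/
abbrev Letter (M n : ℕ) : Type := (Fin (M + 1))ᵒᵈ ×ₗ Fin n

/-- The letter `a^c`. -/
def letter {M n : ℕ} (a : Fin n) (c : Fin (M + 1)) : Letter M n :=
  toLex (OrderDual.toDual c, a)

/-- The alphabet enlarged by letters with a tilde (first component `false`), which are smaller than
all letters without a tilde (first component `true`). -/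
abbrev TildeLetter (M n : ℕ) : Type := Bool ×ₗ Letter M n

/-- The `i`-th letter of `π`. -/
def ColoredPerm.word {M n : ℕ} (π : ColoredPerm M n) (i : Fin n) : Letter M n :=
  letter (π.1 i) (π.2 i)

/-- The excedance set: positions `i` with `π_i > i^0`. -/
def excSet {M n : ℕ} (π : ColoredPerm M n) : Finset (Fin n) :=
  {i | letter i 0 < π.word i}

/-- The excedance number. -/
def exc {M n : ℕ} (π : ColoredPerm M n) : ℕ := (excSet π).card

/-- The number of fixed points of color `k`: positions `i` with `π_i = i^k`. -/
def fixVec {M n : ℕ} (π : ColoredPerm M n) (k : Fin (M + 1)) : ℕ :=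
  Finset.card {i : Fin n | π.word i = letter i k}

/-- The number of letters of the nonzero color `m.succ`. -/
def colVec {M n : ℕ} (π : ColoredPerm M n) (m : Fin M) : ℕ :=
  Finset.card {i : Fin n | π.2 i = m.succ}

/-- The word obtained from `π` by putting a tilde on the letters at excedance positions. -/
def tildeWord {M n : ℕ} (π : ColoredPerm M n) (i : Fin n) : TildeLetter M n :=
  toLex (decide (i ∉ excSet π), π.word i)

/-- The descent set of a word of length `n`.  As positions are counted from `0`, a member `i`
stands for the position `i + 1` in `{1, …, n - 1}`. -/
def desSet {n : ℕ} {A : Type*} [LT A] (w : Fin n → A) : Set ℕ :=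
  {i | ∃ h : i + 1 < n, w ⟨i + 1, h⟩ < w ⟨i, Nat.lt_of_succ_lt h⟩}

/-- The set `DEX(π)`: the descent set of the word with tildes. -/
def dex {M n : ℕ} (π : ColoredPerm M n) : Set ℕ := desSet (tildeWord π)

/-- The index sequences `s_1 ≥ s_2 ≥ ⋯ ≥ s_n ≥ 1` of the monomials of the fundamental
quasisymmetric function: `s_j > s_{j+1}` is required for `j ∈ T` (counted from `0`, as in
`desSet`). -/
def compatSeq (T : Set ℕ) (n : ℕ) : Set (Fin n → ℕ+) :=
  {s | Antitone s ∧
    ∀ (i : ℕ) (h : i + 1 < n), i ∈ T → s ⟨i + 1, h⟩ < s ⟨i, Nat.lt_of_succ_lt h⟩}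

/-- The exponent vector of the monomial `x_{s_1} x_{s_2} ⋯ x_{s_n}`. -/
noncomputable def seqExponent {n : ℕ} (s : Fin n → ℕ+) : ℕ+ →₀ ℕ :=
  ∑ i, Finsupp.single (s i) 1

/-- Every monomial arises from only finitely many sequences, so that the count in the definition
of `fundamentalQSym` is a genuine one. -/
theorem finite_seqExponent_eq (T : Set ℕ) (n : ℕ) (d : ℕ+ →₀ ℕ) :
    {s ∈ compatSeq T n | seqExponent s = d}.Finite := by
  have hfin : {s : Fin n → ℕ+ | ∀ i, s i ∈ (d.support : Set ℕ+)}.Finite := by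
    have := Set.Finite.pi' (ι := Fin n) (κ := fun _ => ℕ+)
      (t := fun _ => (d.support : Set ℕ+)) (fun _ => d.support.finite_toSet)
    exact this
  refine hfin.subset ?_
  rintro s ⟨-, rfl⟩ i
  have h1 : (1 : ℕ) ≤ seqExponent s (s i) := by
    simp only [seqExponent, Finsupp.finsetSum_apply]
    calc (1 : ℕ) = Finsupp.single (s i) 1 (s i) := by simp
      _ ≤ _ := Finset.single_le_sum (f := fun j => Finsupp.single (s j) 1 (s i))
        (fun _ _ => Nat.zero_le _) (Finset.mem_univ i)
  simp only [Finset.mem_coe, Finsupp.mem_support_iff]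
  omega

/-- The fundamental quasisymmetric function
`F_{T,n} = ∑ x_{s_1} x_{s_2} ⋯ x_{s_n}`, the sum over `s ∈ compatSeq T n`, as a formal power series
in `x_1, x_2, …`: the coefficient of a monomial is the number of sequences that give it. -/
noncomputable def fundamentalQSym (T : Set ℕ) (n : ℕ) : MvPowerSeries ℕ+ ℤ :=
  fun d => ({s ∈ compatSeq T n | seqExponent s = d}.ncard : ℤ)

/-- The elementary symmetric function `e_k(x_1, x_2, …)`: the sum of all squarefree monomials of
degree `k`. -/
noncomputable def elemSym (k : ℕ) : MvPowerSeries ℕ+ ℤ :=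
  open Classical in fun d => if d.degree = k ∧ ∀ i, d i ≤ 1 then 1 else 0

/-- The complete homogeneous symmetric function `h_k(x_1, x_2, …)`: the sum of all monomials of
degree `k`. -/
noncomputable def complSym (k : ℕ) : MvPowerSeries ℕ+ ℤ :=
  fun d => if d.degree = k then 1 else 0

/-- The fixed point colored Eulerian quasisymmetric function `Q_{n,j,α,β}`. -/
noncomputable def eulerianQSym {M : ℕ} (n j : ℕ) (α : Fin (M + 1) → ℕ) (β : Fin M → ℕ) :
    MvPowerSeries ℕ+ ℤ :=
  ∑ π : ColoredPerm M n with exc π = j ∧ fixVec π = α ∧ colVec π = β,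
    fundamentalQSym (dex π) n

/-- The colored derangement quasisymmetric function `D_{n,β} = Q_{n,0,0,β}`. -/
noncomputable def derangementQSym {M : ℕ} (n : ℕ) (β : Fin M → ℕ) : MvPowerSeries ℕ+ ℤ :=
  eulerianQSym n 0 0 β

/-- `β(m̂)`: the vector `β` with its `m`-th entry lowered by one (used only if that entry is
positive). -/
def lowerEntry {M : ℕ} (β : Fin M → ℕ) (m : Fin M) : Fin M → ℕ :=
  Function.update β m (β m - 1)

end ColoredEulerian

namespace ColoredEulerian

/-! The coefficient of a monomial in $D_{n,\beta}$ counts pairs of a colored permutation and a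
compatible sequence. Such a pair is the same as a word `u` over the alphabet of pairs (variable,
color): the permutation is the stable sort of `u`, that is, the inverse of its standardization. As
$\beta$ sums to $n$, color 0 does not occur, so there are no excedances and DEX is an ordinary
descent set. Having no fixed points then means that no letter is fixed in `u` in the sense of
`LetterFixed`.

Over any finite ordered alphabet with weights $x_a$, let $U_n(S)$ be the weighted sum of the words
of length $n$ in which no letter of $S$ is fixed. A letter $a$ can be inserted into a word in
exactly one way, as far as the result is concerned, that makes it fixed, and this leaves unchanged
which other letters are fixed. Hence $U_{n+1}(S\cup\{a\})=U_{n+1}(S)-x_aU_n(S)$ for $a\notin S$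
(`unfixedSum_insert`). Induction on $S$ gives $U_{n+1}(S)=(\sum_a x_a)\,U_n(S)+(-1)^{n+1}e_{n+1}(S)$
(`unfixedSum_succ`).

With $S$ the whole alphabet of pairs and weights $s_mx_w$, the coefficient of $s^\beta$ is the
theorem: $e_n$ of the alphabet contributes $\prod_m e_{\beta_m}$, and $\sum_a x_a=\sum_m s_m h_1$
contributes the terms that lower one entry of $\beta$. A single coefficient involves finitely many
variables, so a finite alphabet suffices. -/

theorem exists_append_countP_eq {A : Type*} (p : A → Bool) (l : List A) {k : ℕ} (hk : k ≤ l.countP p) :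
    ∃ l₁ l₂, l = l₁ ++ l₂ ∧ l₁.countP p = k := by
  induction l generalizing k with
  | nil => exact ⟨[], [], rfl, by simp at hk ⊢; omega⟩
  | cons b l ih =>
    rcases Nat.eq_zero_or_pos k with rfl | hk0
    · exact ⟨[], b :: l, rfl, rfl⟩
    · by_cases hb : p b
      · rw [List.countP_cons_of_pos hb] at hk
        obtain ⟨l₁, l₂, rfl, h⟩ := ih (k := k - 1) (by omega)
        exact ⟨b :: l₁, l₂, rfl, by rw [List.countP_cons_of_pos hb]; omega⟩
      · rw [List.countP_cons_of_neg hb] at hk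
        obtain ⟨l₁, l₂, rfl, h⟩ := ih hk
        exact ⟨b :: l₁, l₂, rfl, by rw [List.countP_cons_of_neg hb]; omega⟩

theorem exists_ofFn_eq {A : Type*} {n : ℕ} {l : List A} (h : l.length = n) : ∃ f : Fin n → A, List.ofFn f = l :=
  ⟨fun i => l.get (i.cast h.symm), by subst h; simp⟩

/-! ### Recursion for words without fixed letters, over a finite ordered alphabet -/

section WordsWithFixedLetters

variable {A : Type*} [LinearOrder A]

/-- The letter `a` is fixed in the word `l` if standardization of `l` fixes the position of some
occurrence of `a`: the letters other than `a` in front of that occurrence are as many as the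
letters of `l` smaller than `a`. -/
def LetterFixed (a : A) (l : List A) : Prop :=
  ∃ l₁ l₂, l = l₁ ++ a :: l₂ ∧ l₁.countP (· ≠ a) = l.countP (· < a)

/-- The word `v` arises from `u` by inserting the letter `a` so that it becomes fixed. -/
def FixedInsertion (a : A) (u v : List A) : Prop :=
  ∃ l₁ l₂, u = l₁ ++ l₂ ∧ v = l₁ ++ a :: l₂ ∧ l₁.countP (· ≠ a) = u.countP (· < a)

theorem countP_ne_add_count (a : A) (l : List A) :
    l.countP (· ≠ a) + l.count a = l.length := by
  induction l with
  | nil => simp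
  | cons b l ih =>
    by_cases h : b = a
    · subst h; simp at ih ⊢; omega
    · simp [h] at ih ⊢; omega

theorem countP_lt_add_count_le {a b : A} (h : b < a) (l : List A) :
    l.countP (· < b) + l.count b ≤ l.countP (· < a) := by
  induction l with
  | nil => simp
  | cons c l ih =>
    simp only [List.countP_cons, List.count_cons, decide_eq_true_eq, beq_iff_eq] at ih ⊢
    rcases lt_trichotomy c b with h1 | h1 | h1
    · simp only [h1, h1.trans h, h1.ne, if_true, if_false]; omega
    · subst h1; simp only [h, lt_irrefl, if_true, if_false]; omega
    · simp only [h1.not_gt, h1.ne', if_false]; split_ifs <;> omega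

theorem countP_lt_le_countP_ne (a : A) (l : List A) :
    l.countP (· < a) ≤ l.countP (· ≠ a) :=
  List.countP_mono_left fun x _ hx => by
    simp only [decide_eq_true_eq] at hx ⊢; exact hx.ne

theorem cons_append_comm_of_countP_ne_eq_zero {a : A} {t : List A}
    (ht : t.countP (· ≠ a) = 0) (l : List A) : a :: (t ++ l) = t ++ a :: l := by
  have h : ∀ b ∈ t, b = a := by simpa [List.countP_eq_zero] using ht
  rw [List.eq_replicate_of_mem h, ← List.cons_append, ← List.replicate_succ,
    List.replicate_succ', List.append_assoc]
  rfl

/-- Two insertion points with equally many non-`a` letters in front are separated only by copies of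
`a`, and moving `a` past these does not change the word. -/
theorem insert_eq_insert {a : A} {l₁ l₂ m₁ m₂ : List A} (h : l₁ ++ l₂ = m₁ ++ m₂)
    (hc : l₁.countP (· ≠ a) = m₁.countP (· ≠ a)) : l₁ ++ a :: l₂ = m₁ ++ a :: m₂ := by
  rcases List.append_eq_append_iff.1 h with ⟨t, rfl, rfl⟩ | ⟨t, rfl, rfl⟩ <;>
  · rw [List.countP_append] at hc
    rw [cons_append_comm_of_countP_ne_eq_zero (by omega), List.append_assoc]

theorem remove_eq_remove {a : A} {l₁ l₂ m₁ m₂ : List A} (h : l₁ ++ a :: l₂ = m₁ ++ a :: m₂)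
    (hc : l₁.countP (· ≠ a) = m₁.countP (· ≠ a)) : l₁ ++ l₂ = m₁ ++ m₂ := by
  have key : ∀ {l₁ l₂ m₁ m₂ t : List A}, m₁ = l₁ ++ t → a :: l₂ = t ++ a :: m₂ →
      l₁.countP (· ≠ a) = m₁.countP (· ≠ a) → l₁ ++ l₂ = m₁ ++ m₂ := by
    rintro l₁ l₂ m₁ m₂ t rfl h2 hc
    rw [List.countP_append] at hc
    rw [← cons_append_comm_of_countP_ne_eq_zero (by omega)] at h2
    rw [(List.cons.inj h2).2, List.append_assoc]
  rcases List.append_eq_append_iff.1 h with ⟨t, h1, h2⟩ | ⟨t, h1, h2⟩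
  · exact key h1 h2 hc
  · exact (key h1 h2 hc.symm).symm

theorem exists_fixedInsertion (a : A) (u : List A) : ∃ v, FixedInsertion a u v := by
  obtain ⟨l₁, l₂, h, hc⟩ := exists_append_countP_eq _ u (countP_lt_le_countP_ne a u)
  exact ⟨_, l₁, l₂, h, rfl, hc⟩

namespace FixedInsertion

variable {a b : A} {u u' v v' : List A}

theorem perm (h : FixedInsertion a u v) : v.Perm (a :: u) := by
  obtain ⟨l₁, l₂, rfl, rfl, -⟩ := h
  exact List.perm_middle

theorem letterFixed (h : FixedInsertion a u v) : LetterFixed a v := by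
  obtain ⟨l₁, l₂, rfl, rfl, hc⟩ := h
  exact ⟨l₁, l₂, rfl, by simpa [List.countP_append, List.countP_cons] using hc⟩

theorem left_unique (h : FixedInsertion a u v) (h' : FixedInsertion a u' v) : u = u' := by
  have e : u.countP (· < a) = u'.countP (· < a) := by
    have h1 := h.perm.countP_eq (· < a)
    have h2 := h'.perm.countP_eq (· < a)
    simpa [List.countP_cons] using h1.symm.trans h2
  obtain ⟨l₁, l₂, rfl, rfl, hc⟩ := h
  obtain ⟨m₁, m₂, rfl, hv, hc'⟩ := h'
  exact remove_eq_remove hv (by omega)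

/-- A fixed `b < a` lies in front of the inserted `a`, and a fixed `b > a` behind it, by comparing
positions with the numbers of smaller letters. So the insertion changes neither side of the equation
defining fixedness of `b` when `b < a`, and raises both by one when `a < b`. -/
theorem letterFixed_iff (h : FixedInsertion a u v) (hab : b ≠ a) :
    LetterFixed b v ↔ LetterFixed b u := by
  have hv1 := h.perm.countP_eq (· < b)
  have hv2 := h.perm.count_eq b
  have hv3 := h.perm.countP_eq (· < a)
  have hv4 := h.perm.count_eq a
  obtain ⟨l₁, l₂, rfl, rfl, hc⟩ := h
  have A1 := countP_ne_add_count a l₁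
  have A2 : (l₁ ++ a :: l₂).count a = l₁.count a + l₂.count a + 1 := by
    simp [List.count_append]; omega
  have A3 : (l₁ ++ l₂).count a = l₁.count a + l₂.count a := by
    simp [List.count_append]
  simp only [List.countP_cons, List.count_cons, decide_eq_true_eq, beq_iff_eq, lt_irrefl,
    hab.symm, if_false, if_true] at hv1 hv2 hv3 hv4
  constructor
  · rintro ⟨m₁, m₂, hm, hcm⟩
    have B1 := countP_ne_add_count b m₁
    have B2 : (l₁ ++ a :: l₂).count b = m₁.count b + m₂.count b + 1 := by
      rw [hm]; simp [List.count_append]; omega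
    rcases List.append_eq_append_iff.1 hm with ⟨t, h1, h2⟩ | ⟨t, h1, h2⟩
    · rcases t with _ | ⟨c, t⟩
      · exact absurd (List.cons.inj h2).1.symm hab
      · rw [List.cons_append] at h2
        obtain ⟨rfl, rfl⟩ := List.cons.inj h2
        rcases lt_or_gt_of_ne hab with hlt | hlt
        -- Impossible: the position of a fixed `b < a` is less than the number of letters smaller
        -- than `a`, which is at most the length of `l₁`.
        · have := countP_lt_add_count_le hlt (l₁ ++ a :: (t ++ b :: m₂))
          have := congrArg List.length h1
          simp only [List.length_append, List.length_cons] at this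
          omega
        · refine ⟨l₁ ++ t, m₂, by simp, ?_⟩
          rw [if_pos hlt] at hv1
          rw [h1] at hcm
          simp only [List.countP_append, List.countP_cons, decide_eq_true_eq, ne_eq, hab.symm,
            not_false_eq_true, if_true] at hcm hv1 ⊢
          omega
    · rcases t with _ | ⟨c, t⟩
      · exact absurd (List.cons.inj h2).1 hab
      · rw [List.cons_append] at h2
        obtain ⟨rfl, rfl⟩ := List.cons.inj h2
        rcases lt_or_gt_of_ne hab with hlt | hlt
        · refine ⟨m₁, t ++ l₂, by simp [h1], ?_⟩
          rw [if_neg hlt.not_gt] at hv1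
          omega
        · have := countP_lt_add_count_le hlt (l₁ ++ a :: l₂)
          have := congrArg List.length h1
          simp only [List.length_append, List.length_cons] at this
          omega
  · rintro ⟨m₁, m₂, hm, hcm⟩
    have B1 := countP_ne_add_count b m₁
    have B2 : (l₁ ++ l₂).count b = m₁.count b + m₂.count b + 1 := by
      rw [hm]; simp [List.count_append]; omega
    have fwd : ∀ t, m₁ = l₁ ++ t → l₂ = t ++ b :: m₂ → a < b → LetterFixed b (l₁ ++ a :: l₂) := by
      rintro t rfl rfl hlt
      refine ⟨l₁ ++ a :: t, m₂, by simp, ?_⟩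
      rw [if_pos hlt] at hv1
      rw [hv1, ← hcm]
      simp [List.countP_append, hab.symm]
      omega
    rcases List.append_eq_append_iff.1 hm with ⟨t, h1, h2⟩ | ⟨t, h1, h2⟩
    · rcases lt_or_gt_of_ne hab with hlt | hlt
      · have := countP_lt_add_count_le hlt (l₁ ++ l₂)
        have := congrArg List.length h1
        simp only [List.length_append] at this
        omega
      · exact fwd t h1 h2 hlt
    -- With `t` empty, `b` heads `l₂`, so the inserted `a` comes directly in front of it, and the
    -- case belongs with `fwd`.
    · rcases t with _ | ⟨c, t⟩
      · rcases lt_or_gt_of_ne hab with hlt | hlt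
        · have := countP_lt_add_count_le hlt (l₁ ++ l₂)
          have := congrArg List.length h1
          simp only [List.length_append, List.length_nil] at this
          omega
        · exact fwd [] (by simpa using h1.symm) (by simpa using h2.symm) hlt
      · rw [List.cons_append] at h2
        obtain ⟨rfl, rfl⟩ := List.cons.inj h2
        rcases lt_or_gt_of_ne hab with hlt | hlt
        · refine ⟨m₁, t ++ a :: l₂, by simp [h1], ?_⟩
          rw [if_neg hlt.not_gt] at hv1
          omega
        · have := countP_lt_add_count_le hlt (l₁ ++ l₂)
          have := congrArg List.length h1
          simp only [List.length_append, List.length_cons] at this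
          omega

end FixedInsertion

theorem LetterFixed.exists_fixedInsertion {a : A} {v : List A} (h : LetterFixed a v) :
    ∃ u, FixedInsertion a u v := by
  obtain ⟨l₁, l₂, rfl, hc⟩ := h
  exact ⟨l₁ ++ l₂, l₁, l₂, rfl, rfl, by simpa [List.countP_append, List.countP_cons] using hc⟩

theorem FixedInsertion.right_unique {a : A} {u v v' : List A} (h : FixedInsertion a u v)
    (h' : FixedInsertion a u v') : v = v' := by
  obtain ⟨l₁, l₂, rfl, rfl, hc⟩ := h
  obtain ⟨m₁, m₂, hu, rfl, hc'⟩ := h'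
  exact insert_eq_insert hu (by omega)

variable [Fintype A] {R : Type*} [CommRing R]

open Classical in
/-- The weighted sum over the words of length `n` in which no letter of `S` is fixed. -/
noncomputable def unfixedSum (x : A → R) (n : ℕ) (S : Finset A) : R :=
  ∑ u : Fin n → A with ∀ a ∈ S, ¬ LetterFixed a (List.ofFn u), ∏ i, x (u i)

/-- Inserting `a` as a fixed letter multiplies the weight by `x a` and is a bijection from the words
counted by `unfixedSum x n S` onto those of length `n + 1` that have `a` fixed and no letter of `S`
fixed. -/
theorem unfixedSum_insert (x : A → R) (n : ℕ) {S : Finset A} {a : A} (ha : a ∉ S) :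
    unfixedSum x (n + 1) (insert a S) = unfixedSum x (n + 1) S - x a * unfixedSum x n S := by
  classical
  have hins : ∀ u : Fin n → A, ∃ v : Fin (n + 1) → A,
      FixedInsertion a (List.ofFn u) (List.ofFn v) := fun u => by
    obtain ⟨v, hv⟩ := exists_fixedInsertion a (List.ofFn u)
    obtain ⟨f, rfl⟩ := exists_ofFn_eq (n := n + 1) (l := v) (by simpa using hv.perm.length_eq)
    exact ⟨f, hv⟩
  choose ins hins using hins
  have hstep : x a * unfixedSum x n S =
      ∑ v : Fin (n + 1) → A with
        (∀ b ∈ S, ¬ LetterFixed b (List.ofFn v)) ∧ LetterFixed a (List.ofFn v), ∏ i, x (v i) := by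
    rw [unfixedSum, Finset.mul_sum]
    refine Finset.sum_bij (fun u _ => ins u) ?_ ?_ ?_ ?_
    · intro u hu
      simp only [Finset.mem_filter, Finset.mem_univ, true_and] at hu ⊢
      refine ⟨fun b hb => ?_, (hins u).letterFixed⟩
      rw [(hins u).letterFixed_iff (ne_of_mem_of_not_mem hb ha)]
      exact hu b hb
    · intro u _ u' _ h
      have h1 := hins u
      rw [h] at h1
      exact List.ofFn_injective (h1.left_unique (hins u'))
    · intro v hv
      simp only [Finset.mem_filter, Finset.mem_univ, true_and] at hv
      obtain ⟨u, hu⟩ := hv.2.exists_fixedInsertion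
      obtain ⟨f, rfl⟩ := exists_ofFn_eq (n := n) (l := u) (by
        simpa [eq_comm] using hu.perm.length_eq)
      refine ⟨f, ?_, List.ofFn_injective ((hins f).right_unique hu)⟩
      simp only [Finset.mem_filter, Finset.mem_univ, true_and]
      intro b hb
      rw [← hu.letterFixed_iff (ne_of_mem_of_not_mem hb ha)]
      exact hv.1 b hb
    · intro u _
      have h := ((hins u).perm.map x).prod_eq
      rw [List.map_cons, List.prod_cons, List.map_ofFn, List.map_ofFn, List.prod_ofFn,
        List.prod_ofFn] at h
      exact h.symm
  rw [hstep, unfixedSum, unfixedSum, eq_sub_iff_add_eq,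
    ← Finset.sum_filter_add_sum_filter_not (Finset.univ.filter fun v : Fin (n + 1) → A =>
      ∀ b ∈ S, ¬ LetterFixed b (List.ofFn v)) (fun v => LetterFixed a (List.ofFn v)), add_comm,
    Finset.filter_filter, Finset.filter_filter]
  congr 2
  ext v
  simp [and_comm]

theorem unfixedSum_zero (x : A → R) (S : Finset A) : unfixedSum x 0 S = 1 := by
  simp [unfixedSum, LetterFixed]

theorem unfixedSum_empty (x : A → R) (n : ℕ) : unfixedSum x n ∅ = (∑ a, x a) ^ n := by
  simp [unfixedSum, Finset.sum_pow']

/-- Both sides obey the same recursion in `S`, because $e_{k+1}(S\cup\{a\})=e_{k+1}(S)+x_ae_k(S)$.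
For empty `S` all words are counted and the elementary term vanishes. -/
theorem unfixedSum_succ (x : A → R) (n : ℕ) (S : Finset A) :
    unfixedSum x (n + 1) S = (∑ a, x a) * unfixedSum x n S +
      (-1) ^ (n + 1) * ∑ T ∈ S.powersetCard (n + 1), ∏ a ∈ T, x a := by
  induction S using Finset.induction_on generalizing n with
  | empty =>
    rw [Finset.powersetCard_eq_empty.2 (by simp)]
    simp [unfixedSum_empty, pow_succ']
  | insert a S ha ih =>
    have hesymm : ∀ k, ∑ T ∈ (insert a S).powersetCard (k + 1), ∏ b ∈ T, x b =
        ∑ T ∈ S.powersetCard (k + 1), ∏ b ∈ T, x b +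
          x a * ∑ T ∈ S.powersetCard k, ∏ b ∈ T, x b := fun k => by
      have hT : ∀ T ∈ S.powersetCard k, a ∉ T := fun T hT h =>
        ha ((Finset.mem_powersetCard.1 hT).1 h)
      rw [Finset.powersetCard_succ_insert ha, Finset.sum_union, Finset.sum_image, Finset.mul_sum]
      · congr 1
        exact Finset.sum_congr rfl fun T h => Finset.prod_insert (hT T h)
      · intro T h T' h' e
        rw [← Finset.erase_insert (hT T h), ← Finset.erase_insert (hT T' h'), e]
      · refine Finset.disjoint_left.2 fun T h h' => ?_
        obtain ⟨T', -, rfl⟩ := Finset.mem_image.1 h'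
        exact ha ((Finset.mem_powersetCard.1 h).1 (Finset.mem_insert_self _ _))
    rw [unfixedSum_insert x n ha, hesymm, ih]
    -- For `n = 0` the subtracted sum is over the empty word alone, where the induction hypothesis
    -- does not apply.
    cases n with
    | zero => simp [unfixedSum_zero]; ring
    | succ n => rw [unfixedSum_insert x n ha, ih]; ring

end WordsWithFixedLetters

/-! ### Fixed letters and fixed points of the stable sort -/

section FixedPoints

theorem countP_take_ofFn {A : Type*} {n : ℕ} (q : A → Bool) (u : Fin n → A) (p : ℕ) :
    ((List.ofFn u).take p).countP q = Finset.card {k : Fin n | k.1 < p ∧ q (u k)} := by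
  induction n generalizing p with
  | zero => simp
  | succ n ih =>
    cases p with
    | zero => simp
    | succ p =>
      rw [List.ofFn_succ, List.take_succ_cons, List.countP_cons, ih, Fin.card_filter_univ_succ]
      by_cases h : q (u 0) <;> simp [h]

variable {A : Type*} [LinearOrder A] {n : ℕ}

theorem letterFixed_iff_exists_getElem (a : A) (l : List A) :
    LetterFixed a l ↔ ∃ (p : ℕ) (h : p < l.length), l[p] = a ∧
      (l.take p).countP (· ≠ a) = l.countP (· < a) := by
  constructor
  · rintro ⟨l₁, l₂, rfl, h⟩
    exact ⟨l₁.length, by simp, by simp, by simpa using h⟩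
  · rintro ⟨p, hp, rfl, h⟩
    exact ⟨l.take p, l.drop (p + 1), by simp, h⟩

/-- The position `p`, counted from 0, is the number of non-`a` letters in front plus the number of
copies of `a` in front. The rank of `p` in the stable order is the number of smaller letters plus
the same number of copies, which cancels. -/
theorem letterFixed_ofFn (a : A) (u : Fin n → A) :
    LetterFixed a (List.ofFn u) ↔
      ∃ p, u p = a ∧ Finset.card {k | toLex (u k, k) < toLex (u p, p)} = p.1 := by
  have key : ∀ p, u p = a → (((List.ofFn u).take p).countP (· ≠ a) = (List.ofFn u).countP (· < a) ↔
      Finset.card {k | toLex (u k, k) < toLex (u p, p)} = p.1) := by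
    rintro p rfl
    have h1 : (List.ofFn u).countP (· < u p) = Finset.card {k | u k < u p} := by
      have := countP_take_ofFn (· < u p) u n
      rw [List.take_of_length_le (by simp)] at this
      simpa using this
    have h2 : Finset.card {k | toLex (u k, k) < toLex (u p, p)} =
        Finset.card {k | u k < u p} + Finset.card {k | k < p ∧ u k = u p} := by
      rw [← Finset.card_union_of_disjoint]
      · congr 1
        ext k
        simp [Prod.Lex.toLex_lt_toLex, and_comm]
      · refine Finset.disjoint_filter.2 fun k _ h h' => ?_
        exact h.ne h'.2
    have h3 : Finset.card {k : Fin n | k < p ∧ u k = u p} +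
        Finset.card {k : Fin n | k < p ∧ ¬ u k = u p} = p := by
      rw [← Finset.filter_filter, ← Finset.filter_filter, Finset.card_filter_add_card_filter_not]
      exact (congrArg Finset.card (by ext; simp)).trans (Fin.card_Iio p)
    have h4 : Finset.card {k : Fin n | k.1 < p.1 ∧ decide (u k ≠ u p) = true} =
        Finset.card {k : Fin n | k < p ∧ ¬ u k = u p} := by
      congr 1
      ext k
      simp
    rw [countP_take_ofFn, h1, h2, h4]
    omega
  rw [letterFixed_iff_exists_getElem]
  constructor
  · rintro ⟨p, hp, h, hc⟩
    rw [List.length_ofFn] at hp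
    rw [List.getElem_ofFn] at h
    exact ⟨⟨p, hp⟩, h, (key ⟨p, hp⟩ h).1 hc⟩
  · rintro ⟨p, h, hc⟩
    exact ⟨p, by simp, by simpa using h, (key p h).2 hc⟩

theorem strictMono_iff_eq_sort (u : Fin n → A) (σ : Equiv.Perm (Fin n)) :
    σ = Tuple.sort u ↔ StrictMono fun i => toLex (u (σ i), σ i) :=
  Tuple.eq_sort_iff'

/-- The standardization of `u` is the inverse of the stable sort; the two have the same fixed
points. -/
theorem card_toLex_lt (u : Fin n → A) (p : Fin n) :
    Finset.card {k | toLex (u k, k) < toLex (u p, p)} = ((Tuple.sort u).symm p).1 := by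
  have hmono := (strictMono_iff_eq_sort u _).1 rfl
  rw [← Fin.card_Iio, ← (Finset.Iio _).card_map (Tuple.sort u).toEmbedding]
  congr 1
  ext k
  obtain ⟨i, rfl⟩ := (Tuple.sort u).surjective k
  obtain ⟨j, rfl⟩ := (Tuple.sort u).surjective p
  simpa using hmono.lt_iff_lt

theorem forall_not_letterFixed_iff (u : Fin n → A) :
    (∀ a, ¬ LetterFixed a (List.ofFn u)) ↔ ∀ i, Tuple.sort u i ≠ i := by
  simp only [letterFixed_ofFn, card_toLex_lt, not_exists, not_and, Fin.val_inj,
    Equiv.symm_apply_eq]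
  exact ⟨fun h i e => h _ i rfl e.symm, fun h a p _ e => h p e.symm⟩

end FixedPoints

/-! ### Words of pairs (variable, color) and colored derangements -/

section Biwords

/-- Pairs of a variable `x_w`, `w ∈ W`, and a nonzero color, ordered by decreasing `w` and then by
decreasing color. -/
abbrev BiLetter (W : Finset ℕ+) (M : ℕ) : Type := (W)ᵒᵈ ×ₗ (Fin M)ᵒᵈ

variable {W : Finset ℕ+} {M n : ℕ}

/-- The index of the variable. -/
def BiLetter.var (a : BiLetter W M) : ℕ+ := (OrderDual.ofDual (ofLex a).1).1

/-- The color. -/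
def BiLetter.col (a : BiLetter W M) : Fin M := OrderDual.ofDual (ofLex a).2

theorem BiLetter.lt_iff {a b : BiLetter W M} :
    a < b ↔ b.var < a.var ∨ a.var = b.var ∧ b.col < a.col := by
  rw [Prod.Lex.lt_iff]
  refine or_congr Iff.rfl (and_congr ?_ Iff.rfl)
  rw [BiLetter.var, BiLetter.var, Subtype.coe_inj, OrderDual.ofDual_inj]

theorem BiLetter.ext_iff {a b : BiLetter W M} : a = b ↔ a.var = b.var ∧ a.col = b.col := by
  rw [BiLetter.var, BiLetter.var, Subtype.coe_inj, BiLetter.col, BiLetter.col,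
    OrderDual.ofDual_inj, OrderDual.ofDual_inj, ← Prod.ext_iff]
  exact ofLex_inj.symm

theorem letter_lt_letter {a b : Fin n} {c e : Fin (M + 1)} :
    letter a c < letter b e ↔ e < c ∨ c = e ∧ a < b := by
  rw [letter, letter, Prod.Lex.toLex_lt_toLex]
  simp

theorem letter_inj {a b : Fin n} {c e : Fin (M + 1)} :
    letter a c = letter b e ↔ a = b ∧ c = e := by
  simp [letter, and_comm]

theorem excSet_eq_empty {π : ColoredPerm M n} (h : ∀ i, π.2 i ≠ 0) : excSet π = ∅ := by
  refine Finset.filter_eq_empty_iff.2 fun i _ hi => ?_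
  rcases letter_lt_letter.1 hi with h1 | h1
  · exact absurd h1 (Fin.not_lt_zero _)
  · exact h i h1.1.symm

theorem dex_eq_desSet_word {π : ColoredPerm M n} (h : excSet π = ∅) :
    dex π = desSet π.word := by
  simp [dex, desSet, tildeWord, h, Prod.Lex.toLex_lt_toLex]

theorem fixVec_eq_zero_iff {π : ColoredPerm M n} : fixVec π = 0 ↔ ∀ i, π.1 i ≠ i := by
  simp only [funext_iff, fixVec, Pi.zero_apply, Finset.card_eq_zero, Finset.filter_eq_empty_iff,
    Finset.mem_univ, true_imp_iff, ColoredPerm.word, letter_inj, not_and]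
  exact ⟨fun h i e => h (π.2 i) e rfl, fun h k i e => absurd e (h i)⟩

theorem color_ne_zero_of_sum_colVec {π : ColoredPerm M n} (h : ∑ m, colVec π m = n) (i : Fin n) :
    π.2 i ≠ 0 := by
  have h1 := Finset.card_eq_sum_card_fiberwise (s := (Finset.univ : Finset (Fin n)))
    (t := Finset.univ) (f := π.2) (fun _ _ => Finset.mem_univ _)
  rw [Fin.sum_univ_succ, Finset.card_univ, Fintype.card_fin] at h1
  have h2 : ∑ m : Fin M, Finset.card {i : Fin n | π.2 i = m.succ} = n := h
  rw [h2] at h1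
  have h3 : Finset.card {i : Fin n | π.2 i = 0} = 0 := by omega
  exact Finset.filter_eq_empty_iff.1 (Finset.card_eq_zero.1 h3) (Finset.mem_univ i)

/-- Ties in `s` are allowed exactly at positions that are not descents, and for injective `w` these
are strict ascents. -/
theorem mem_compatSeq_desSet_iff {B : Type*} [LinearOrder B] {w : Fin n → B}
    (hw : Function.Injective w) (s : Fin n → ℕ+) :
    s ∈ compatSeq (desSet w) n ↔
      StrictMono fun i => (toLex (OrderDual.toDual (s i), w i) : ℕ+ᵒᵈ ×ₗ B) := by
  constructor
  · rintro ⟨hs, hT⟩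
    cases n with
    | zero => exact fun i => i.elim0
    | succ n =>
      refine Fin.strictMono_iff_lt_succ.2 fun i => Prod.Lex.toLex_lt_toLex.2 ?_
      have hle : s i.succ ≤ s i.castSucc := hs i.castSucc_lt_succ.le
      rcases hle.lt_or_eq with h | h
      · exact Or.inl h
      · refine Or.inr ⟨by rw [h], ?_⟩
        refine lt_of_le_of_ne (not_lt.1 fun hlt => ?_) (hw.ne i.castSucc_lt_succ.ne)
        exact (hT i.1 (by omega) ⟨by omega, hlt⟩).ne h
  · intro h
    refine ⟨fun i j hij => ?_, fun i hi hT => ?_⟩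
    · rcases Prod.Lex.toLex_le_toLex.1 (h.monotone hij) with h1 | h1
      · exact le_of_lt h1
      · exact (OrderDual.toDual_inj.1 h1.1).ge
    · obtain ⟨_, hlt⟩ := hT
      have : (⟨i, by omega⟩ : Fin n) < ⟨i + 1, hi⟩ := Fin.mk_lt_mk.2 (Nat.lt_succ_self i)
      rcases Prod.Lex.toLex_lt_toLex.1 (h this) with h1 | h1
      · exact h1
      · exact absurd hlt h1.2.not_gt

/-- Both conditions say that the triples of variable (decreasing), color (decreasing) and value
(increasing) grow strictly along the word; the order on `BiLetter` is chosen for this. -/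
theorem eq_sort_iff_mem_compatSeq {π : ColoredPerm M n} {u : Fin n → BiLetter W M}
    (hc : ∀ i, π.2 i = (u (π.1 i)).col.succ) :
    π.1 = Tuple.sort u ↔ (fun i => (u (π.1 i)).var) ∈ compatSeq (dex π) n := by
  have hinj : Function.Injective π.word := fun i j h => π.1.injective (letter_inj.1 h).1
  rw [dex_eq_desSet_word (excSet_eq_empty fun i => by rw [hc]; exact Fin.succ_ne_zero _),
    mem_compatSeq_desSet_iff hinj, strictMono_iff_eq_sort]
  refine forall₂_congr fun i j => imp_congr_right fun _ => ?_
  simp only [Prod.Lex.toLex_lt_toLex, ColoredPerm.word, letter_lt_letter, hc, BiLetter.lt_iff,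
    BiLetter.ext_iff, OrderDual.toDual_lt_toDual, OrderDual.toDual_inj, Fin.succ_lt_succ_iff,
    Fin.succ_inj]
  tauto

/-- The colored permutation that sorts a word. -/
def sortingPerm (u : Fin n → BiLetter W M) : ColoredPerm M n :=
  (Tuple.sort u, fun i => (u (Tuple.sort u i)).col.succ)

theorem colVec_sortingPerm (u : Fin n → BiLetter W M) (m : Fin M) :
    colVec (sortingPerm u) m = Finset.card {i | (u i).col = m} := by
  rw [colVec, ← Finset.card_map (Tuple.sort u).toEmbedding]
  congr 1
  ext k
  obtain ⟨i, rfl⟩ := (Tuple.sort u).surjective k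
  simp [sortingPerm]

theorem mem_support_seqExponent (s : Fin n → ℕ+) (i : Fin n) : s i ∈ (seqExponent s).support := by
  rw [seqExponent, Finsupp.mem_support_iff, Finsupp.finsetSum_apply]
  refine (Finset.sum_pos' (fun _ _ => Nat.zero_le _) ⟨i, Finset.mem_univ i, ?_⟩).ne'
  simp

theorem seqExponent_comp_perm (s : Fin n → ℕ+) (σ : Equiv.Perm (Fin n)) :
    seqExponent (fun i => s (σ i)) = seqExponent s :=
  Equiv.sum_comp σ fun i => Finsupp.single (s i) 1

open Classical in
-- For given `π`, a word that sorts to `π` amounts to a compatible sequence: the variables read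
-- along `π` are the sequence, and the colors are dictated by `π`.
theorem ncard_compatSeq_eq {d : ℕ+ →₀ ℕ} (hd : d.support ⊆ W) {π : ColoredPerm M n}
    (hπ : ∀ i, π.2 i ≠ 0) :
    {s ∈ compatSeq (dex π) n | seqExponent s = d}.ncard =
      Finset.card {u : Fin n → BiLetter W M |
        seqExponent (fun i => (u i).var) = d ∧ sortingPerm u = π} := by
  rw [← Set.ncard_coe_finset]
  symm
  refine Set.ncard_congr (fun u _ i => (u (π.1 i)).var) ?_ ?_ ?_
  · intro u hu
    simp only [Finset.coe_filter, Finset.mem_univ, true_and, Set.mem_ofPred_eq] at hu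
    obtain ⟨hu, rfl⟩ := hu
    refine ⟨(eq_sort_iff_mem_compatSeq fun i => rfl).1 rfl, ?_⟩
    rw [seqExponent_comp_perm (fun i => (u i).var), hu]
  · intro u v hu hv h
    simp only [Finset.coe_filter, Finset.mem_univ, true_and, Set.mem_ofPred_eq] at hu hv
    funext k
    obtain ⟨i, rfl⟩ := π.1.surjective k
    refine BiLetter.ext_iff.2 ⟨congrFun h i, Fin.succ_injective _ ?_⟩
    have h1 : ∀ {u : Fin n → BiLetter W M}, sortingPerm u = π →
        (u (π.1 i)).col.succ = π.2 i := by rintro u rfl; rfl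
    rw [h1 hu.2, h1 hv.2]
  · rintro s ⟨hs, hsd⟩
    have hW : ∀ i, s i ∈ W := fun i => hd (hsd ▸ mem_support_seqExponent s i)
    let u : Fin n → BiLetter W M := fun k => toLex
      (OrderDual.toDual ⟨s (π.1.symm k), hW _⟩,
        OrderDual.toDual ((π.2 (π.1.symm k)).pred (hπ _)))
    have hvar : (fun i => (u (π.1 i)).var) = s := by
      funext i; simp [u, BiLetter.var]
    have hcol : ∀ i, π.2 i = (u (π.1 i)).col.succ := by
      intro i; simp [u, BiLetter.col]
    refine ⟨u, ?_, hvar⟩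
    simp only [Finset.coe_filter, Finset.mem_univ, true_and, Set.mem_ofPred_eq]
    constructor
    · rw [← seqExponent_comp_perm _ π.1, hvar, hsd]
    · rw [← hvar] at hs
      have h := (eq_sort_iff_mem_compatSeq hcol).2 hs
      refine Prod.ext h.symm (funext fun i => ?_)
      rw [hcol, h]
      rfl

open Classical in
theorem coeff_derangementQSym {d : ℕ+ →₀ ℕ} (hd : d.support ⊆ W) {β : Fin M → ℕ}
    (hβ : ∑ m, β m = n) :
    MvPowerSeries.coeff d (derangementQSym n β) =
      (Finset.card {u : Fin n → BiLetter W M | (∀ a, ¬ LetterFixed a (List.ofFn u)) ∧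
        (∀ m, Finset.card {i | (u i).col = m} = β m) ∧
          seqExponent (fun i => (u i).var) = d} : ℤ) := by
  have hpos : ∀ π : ColoredPerm M n, colVec π = β → ∀ i, π.2 i ≠ 0 := by
    rintro π rfl
    exact color_ne_zero_of_sum_colVec hβ
  have hmem : ∀ u : Fin n → BiLetter W M,
      (exc (sortingPerm u) = 0 ∧ fixVec (sortingPerm u) = 0 ∧ colVec (sortingPerm u) = β) ↔
      (∀ a, ¬ LetterFixed a (List.ofFn u)) ∧ ∀ m, Finset.card {i | (u i).col = m} = β m := by
    intro u
    have h0 : exc (sortingPerm u) = 0 :=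
      Finset.card_eq_zero.2 (excSet_eq_empty fun i => Fin.succ_ne_zero _)
    rw [fixVec_eq_zero_iff, forall_not_letterFixed_iff, funext_iff]
    simp only [h0, colVec_sortingPerm, true_and]
    rfl
  -- The words are grouped by the colored permutation that sorts them.
  rw [derangementQSym, eulerianQSym, map_sum]
  rw [Finset.card_eq_sum_card_fiberwise (f := sortingPerm)
    (t := {π : ColoredPerm M n | exc π = 0 ∧ fixVec π = 0 ∧ colVec π = β}), Nat.cast_sum]
  · refine Finset.sum_congr rfl fun π hπ => ?_
    simp only [Finset.mem_filter, Finset.mem_univ, true_and] at hπ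
    refine Eq.trans (congrArg Nat.cast (ncard_compatSeq_eq hd (hpos π hπ.2.2))) ?_
    congr 2
    ext u
    simp only [Finset.mem_filter, Finset.mem_univ, true_and]
    constructor
    · rintro ⟨h1, rfl⟩
      exact ⟨⟨((hmem u).1 hπ).1, ((hmem u).1 hπ).2, h1⟩, rfl⟩
    · rintro ⟨⟨_, _, h1⟩, h2⟩
      exact ⟨h1, h2⟩
  · intro u hu
    simp only [Finset.coe_filter, Finset.mem_univ, true_and, Set.mem_ofPred_eq] at hu ⊢
    exact (hmem u).2 ⟨hu.1, hu.2.1⟩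

end Biwords

/-! ### Reduction to finitely many variables -/

section Truncation

/-- Equality of the coefficients of all monomials in the variables indexed by `W`. -/
def AgreeOn (W : Finset ℕ+) (f g : MvPowerSeries ℕ+ ℤ) : Prop :=
  ∀ d : ℕ+ →₀ ℕ, d.support ⊆ W → MvPowerSeries.coeff d f = MvPowerSeries.coeff d g

namespace AgreeOn

variable {W : Finset ℕ+} {f g f' g' : MvPowerSeries ℕ+ ℤ}

theorem refl (f : MvPowerSeries ℕ+ ℤ) : AgreeOn W f f := fun _ _ => rfl

theorem add (h : AgreeOn W f g) (h' : AgreeOn W f' g') : AgreeOn W (f + f') (g + g') :=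
  fun d hd => by rw [map_add, map_add, h d hd, h' d hd]

theorem mul (h : AgreeOn W f g) (h' : AgreeOn W f' g') : AgreeOn W (f * f') (g * g') := by
  classical
  intro d hd
  rw [MvPowerSeries.coeff_mul, MvPowerSeries.coeff_mul]
  refine Finset.sum_congr rfl fun p hp => ?_
  have hp := Finset.HasAntidiagonal.mem_antidiagonal.1 hp
  rw [h p.1 ((Finsupp.support_mono (hp ▸ le_self_add)).trans hd),
    h' p.2 ((Finsupp.support_mono (hp ▸ le_add_self)).trans hd)]

theorem sum {ι : Type*} {s : Finset ι} {f g : ι → MvPowerSeries ℕ+ ℤ}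
    (h : ∀ i ∈ s, AgreeOn W (f i) (g i)) : AgreeOn W (∑ i ∈ s, f i) (∑ i ∈ s, g i) :=
  fun d hd => by
    rw [map_sum, map_sum]
    exact Finset.sum_congr rfl fun i hi => h i hi d hd

theorem prod {ι : Type*} {s : Finset ι} {f g : ι → MvPowerSeries ℕ+ ℤ}
    (h : ∀ i ∈ s, AgreeOn W (f i) (g i)) : AgreeOn W (∏ i ∈ s, f i) (∏ i ∈ s, g i) := by
  classical
  induction s using Finset.induction_on with
  | empty => exact refl _
  | insert i s hi ih =>
    rw [Finset.prod_insert hi, Finset.prod_insert hi]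
    exact (h i (Finset.mem_insert_self _ _)).mul
      (ih fun j hj => h j (Finset.mem_insert_of_mem hj))

end AgreeOn

theorem prod_X_eq_monomial {ι : Type*} (s : Finset ι) (f : ι → ℕ+) :
    ∏ i ∈ s, (MvPowerSeries.X (f i) : MvPowerSeries ℕ+ ℤ) =
      MvPowerSeries.monomial (∑ i ∈ s, Finsupp.single (f i) 1) 1 := by
  classical
  induction s using Finset.induction_on with
  | empty => simp
  | insert i s hi ih =>
    rw [Finset.prod_insert hi, Finset.sum_insert hi, ih, MvPowerSeries.X,
      MvPowerSeries.monomial_mul_monomial, one_mul]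

theorem agreeOn_elemSym (W : Finset ℕ+) (k : ℕ) :
    AgreeOn W (elemSym k) (∑ U ∈ W.powersetCard k, ∏ i ∈ U, MvPowerSeries.X i) := by
  classical
  intro d hd
  have hval : ∀ (U : Finset ℕ+) (i : ℕ+),
      (∑ j ∈ U, Finsupp.single j 1 : ℕ+ →₀ ℕ) i = if i ∈ U then 1 else 0 := fun U i => by
    rw [Finsupp.finsetSum_apply]
    simp [Finsupp.single_apply]
  have hsupp : ∀ U : Finset ℕ+, d = ∑ j ∈ U, Finsupp.single j 1 → U = d.support := by
    rintro U rfl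
    ext i
    rw [Finsupp.mem_support_iff, hval]
    simp
  have hX : ∀ U : Finset ℕ+, ∏ i ∈ U, (MvPowerSeries.X i : MvPowerSeries ℕ+ ℤ) =
      MvPowerSeries.monomial (∑ i ∈ U, Finsupp.single i 1) 1 :=
    fun U => prod_X_eq_monomial U fun i => i
  simp only [map_sum, hX, MvPowerSeries.coeff_monomial]
  change (if d.degree = k ∧ ∀ i, d i ≤ 1 then (1 : ℤ) else 0) = _
  split_ifs with h
  · have hd1 : d = ∑ j ∈ d.support, Finsupp.single j 1 := by
      ext i
      rw [hval]
      have := h.2 i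
      split_ifs with hi
      · rw [Finsupp.mem_support_iff] at hi; omega
      · simpa using hi
    rw [Finset.sum_eq_single d.support, if_pos hd1]
    · exact fun U _ hU => if_neg fun e => hU (hsupp U e)
    · refine fun hU => absurd (Finset.mem_powersetCard.2 ⟨hd, ?_⟩) hU
      rw [← h.1, Finsupp.degree_apply, Finset.card_eq_sum_ones]
      refine Finset.sum_congr rfl fun i hi => ?_
      have := h.2 i
      rw [Finsupp.mem_support_iff] at hi
      omega
  · symm
    refine Finset.sum_eq_zero fun U hU => if_neg fun e => h ⟨?_, fun i => ?_⟩
    · rw [e, map_sum]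
      simpa using (Finset.mem_powersetCard.1 hU).2
    · rw [e, hval]
      split_ifs <;> omega

theorem complSym_one : complSym 1 = elemSym 1 := by
  classical
  funext d
  change (if d.degree = 1 then (1 : ℤ) else 0) = if d.degree = 1 ∧ ∀ i, d i ≤ 1 then 1 else 0
  refine if_congr ⟨fun h => ⟨h, fun i => h ▸ Finsupp.le_degree i d⟩, And.left⟩ rfl rfl

theorem agreeOn_complSym_one (W : Finset ℕ+) :
    AgreeOn W (complSym 1) (∑ i ∈ W, MvPowerSeries.X i) := by
  have := agreeOn_elemSym W 1
  rw [Finset.powersetCard_one, Finset.sum_map, ← complSym_one] at this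
  simpa using this

end Truncation

/-! ### Extraction of the coefficient that records the colors -/

section Weights

theorem prod_monomial {ι σ R : Type*} [CommSemiring R] (s : Finset ι) (e : ι → σ →₀ ℕ)
    (c : ι → R) : ∏ i ∈ s, MvPolynomial.monomial (e i) (c i) =
      MvPolynomial.monomial (∑ i ∈ s, e i) (∏ i ∈ s, c i) := by
  classical
  induction s using Finset.induction_on with
  | empty => simp
  | insert i s hi ih =>
    rw [Finset.prod_insert hi, Finset.sum_insert hi, Finset.prod_insert hi, ih,
      MvPolynomial.monomial_mul]

variable {W : Finset ℕ+} {M : ℕ}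

/-- The weight `s_m x_w` of a letter, in which `s_m` records the color. -/
noncomputable def BiLetter.weight (a : BiLetter W M) :
    MvPolynomial (Fin M) (MvPowerSeries ℕ+ ℤ) :=
  MvPolynomial.monomial (Finsupp.single a.col 1) (MvPowerSeries.X a.var)

theorem prod_biLetter {R : Type*} [CommMonoid R] (f : Fin M → ℕ+ → R) :
    ∏ a : BiLetter W M, f a.col a.var = ∏ m, ∏ w ∈ W, f m w := by
  let e : Fin M × W ≃ BiLetter W M :=
    (Equiv.prodComm _ _).trans ((OrderDual.toDual.prodCongr OrderDual.toDual).trans toLex)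
  rw [← Equiv.prod_comp e, Fintype.prod_prod_type]
  exact Finset.prod_congr rfl fun m _ => Finset.prod_coe_sort W (f m)

theorem sum_biLetter {R : Type*} [AddCommMonoid R] (f : Fin M → ℕ+ → R) :
    ∑ a : BiLetter W M, f a.col a.var = ∑ m, ∑ w ∈ W, f m w :=
  prod_biLetter (R := Multiplicative R) f

theorem sum_single_eq_iff {ι : Type*} [Fintype ι] (c : ι → Fin M) (β : Fin M →₀ ℕ) :
    β = ∑ i, Finsupp.single (c i) 1 ↔ ∀ m, Finset.card {i | c i = m} = β m := by
  rw [Finsupp.ext_iff]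
  refine forall_congr' fun m => ?_
  rw [Finsupp.finsetSum_apply, Finset.card_filter]
  simp only [Finsupp.single_apply]
  exact eq_comm

/-- The sum of the monomials of the words with colors counted by `β` in which no letter is fixed. -/
noncomputable def unfixedColoredSum (W : Finset ℕ+) {M : ℕ} (n : ℕ) (β : Fin M →₀ ℕ) :
    MvPowerSeries ℕ+ ℤ :=
  MvPolynomial.coeff β (unfixedSum (A := BiLetter W M) BiLetter.weight n Finset.univ)

theorem agreeOn_derangementQSym {n : ℕ} (β : Fin M →₀ ℕ) (hβ : ∑ m, β m = n) :
    AgreeOn W (derangementQSym n β)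
      (unfixedColoredSum W n β) := by
  classical
  intro d hd
  rw [coeff_derangementQSym hd hβ, unfixedColoredSum, unfixedSum, MvPolynomial.coeff_sum, map_sum,
    Finset.card_filter, Finset.sum_filter, Nat.cast_sum]
  refine Finset.sum_congr rfl fun u _ => ?_
  have hwt : MvPowerSeries.coeff d (MvPolynomial.coeff β (∏ i, (u i).weight)) =
      if (∀ m, Finset.card {i | (u i).col = m} = β m) ∧ seqExponent (fun i => (u i).var) = d
        then 1 else 0 := by
    simp only [BiLetter.weight]
    rw [prod_monomial, MvPolynomial.coeff_monomial, prod_X_eq_monomial, ite_and,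
      apply_ite (MvPowerSeries.coeff d), MvPowerSeries.coeff_monomial, map_zero]
    refine if_congr ?_ (if_congr eq_comm rfl rfl) rfl
    rw [eq_comm, sum_single_eq_iff]
  simp only [Finset.mem_univ, true_imp_iff]
  by_cases h : ∀ a, ¬ LetterFixed a (List.ofFn u)
  · rw [if_pos h, hwt]
    simp [h]
  · simp only [h, false_and, if_false, Nat.cast_zero]

/-- The generating function of all subsets of the alphabet is $\prod_{m,w}(1+s_mx_w)$, which factors
over the colors; the coefficient of $s^\beta$ takes $e_{\beta_m}$ from the factor of color $m$. -/
theorem coeff_esymm_weight {n : ℕ} (β : Fin M →₀ ℕ) (hβ : ∑ m, β m = n) :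
    MvPolynomial.coeff β (∑ T ∈ (Finset.univ : Finset (BiLetter W M)).powersetCard n,
      ∏ a ∈ T, a.weight) = ∏ m, ∑ U ∈ W.powersetCard (β m), ∏ i ∈ U, MvPowerSeries.X i := by
  classical
  -- A subset `T` contributes degree `T.card` in the color variables, so only those with `n`
  -- elements reach `β`, and the restriction on size can be dropped.
  have hall : MvPolynomial.coeff β (∑ T ∈ (Finset.univ : Finset (BiLetter W M)).powersetCard n,
      ∏ a ∈ T, a.weight) = MvPolynomial.coeff β
        (∑ T ∈ (Finset.univ : Finset (BiLetter W M)).powerset, ∏ a ∈ T, a.weight) := by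
    rw [MvPolynomial.coeff_sum, MvPolynomial.coeff_sum]
    refine Finset.sum_subset (fun T _ => by simp) fun T _ hT => ?_
    simp only [BiLetter.weight]
    rw [prod_monomial, MvPolynomial.coeff_monomial]
    refine if_neg fun e => hT (Finset.mem_powersetCard.2 ⟨Finset.subset_univ _, ?_⟩)
    have := congrArg Finsupp.degree e
    rw [map_sum, Finsupp.degree_eq_sum, hβ] at this
    simpa using this
  have hfac : ∀ m : Fin M, ∏ w ∈ W, (1 + MvPolynomial.monomial (Finsupp.single m 1)
        (MvPowerSeries.X w : MvPowerSeries ℕ+ ℤ)) =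
      ∑ U ∈ W.powerset, MvPolynomial.monomial (Finsupp.single m U.card)
        (∏ i ∈ U, MvPowerSeries.X i) := fun m => by
    rw [Finset.prod_one_add]
    refine Finset.sum_congr rfl fun U _ => ?_
    rw [prod_monomial, Finset.sum_const, Finsupp.smul_single, smul_eq_mul, mul_one]
  have hprod : ∑ T ∈ (Finset.univ : Finset (BiLetter W M)).powerset, ∏ a ∈ T, a.weight =
      ∑ U ∈ Fintype.piFinset fun _ : Fin M => W.powerset,
        MvPolynomial.monomial (∑ m, Finsupp.single m (U m).card)
          (∏ m, ∏ i ∈ U m, (MvPowerSeries.X i : MvPowerSeries ℕ+ ℤ)) := by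
    rw [← Finset.prod_one_add]
    refine (prod_biLetter fun m w => 1 + MvPolynomial.monomial (Finsupp.single m 1)
        (MvPowerSeries.X w : MvPowerSeries ℕ+ ℤ)).trans ?_
    simp only [hfac, Finset.prod_univ_sum, prod_monomial]
  rw [hall, hprod, MvPolynomial.coeff_sum, Finset.prod_univ_sum]
  simp only [MvPolynomial.coeff_monomial]
  rw [← Finset.sum_filter]
  refine Finset.sum_congr ?_ fun _ _ => rfl
  ext U
  have hU : ∑ m, Finsupp.single m (U m).card = β ↔ ∀ m, (U m).card = β m := by
    rw [Finsupp.ext_iff]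
    refine forall_congr' fun m => ?_
    rw [Finsupp.finsetSum_apply]
    simp [Finsupp.single_apply]
  simp only [Finset.mem_filter, Fintype.mem_piFinset, Finset.mem_powerset, hU,
    Finset.mem_powersetCard, forall_and]

theorem coeff_sum_weight_mul (β : Fin M →₀ ℕ) (f : MvPolynomial (Fin M) (MvPowerSeries ℕ+ ℤ)) :
    MvPolynomial.coeff β ((∑ a : BiLetter W M, a.weight) * f) =
      ∑ m, if 0 < β m then
        MvPolynomial.coeff (β - Finsupp.single m 1) f * ∑ w ∈ W, MvPowerSeries.X w else 0 := by
  rw [Finset.sum_mul, MvPolynomial.coeff_sum]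
  simp only [BiLetter.weight, MvPolynomial.coeff_monomial_mul']
  refine (sum_biLetter fun m w => if Finsupp.single m 1 ≤ β then
    MvPowerSeries.X w * MvPolynomial.coeff (β - Finsupp.single m 1) f else 0).trans ?_
  refine Finset.sum_congr rfl fun m _ => ?_
  simp only [Finsupp.single_le_iff, Nat.one_le_iff_ne_zero, Nat.pos_iff_ne_zero]
  split_ifs
  · rw [← Finset.sum_mul, mul_comm]
  · exact Finset.sum_const_zero

theorem unfixedColoredSum_eq {n : ℕ} (β : Fin M →₀ ℕ) (hβ : ∑ m, β m = n) :
    unfixedColoredSum W n β =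
      (-1) ^ n * ∏ m, ∑ U ∈ W.powersetCard (β m), ∏ i ∈ U, MvPowerSeries.X i +
        ∑ m, if 0 < β m then unfixedColoredSum W (n - 1) (β - Finsupp.single m 1) *
          ∑ w ∈ W, MvPowerSeries.X w else 0 := by
  cases n with
  | zero =>
    -- All entries of `β` vanish, so the truncated `n - 1` is never used: both sides equal 1.
    have h0 : ∀ m, β m = 0 := by simpa using hβ
    have h1 : β = 0 := Finsupp.ext h0
    simp [unfixedColoredSum, unfixedSum_zero, h1]
  | succ k =>
    have hsign : ((-1) ^ (k + 1) : MvPolynomial (Fin M) (MvPowerSeries ℕ+ ℤ)) =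
        MvPolynomial.C ((-1) ^ (k + 1)) := by simp
    rw [unfixedColoredSum, unfixedSum_succ, MvPolynomial.coeff_add, coeff_sum_weight_mul, hsign,
      MvPolynomial.coeff_C_mul, coeff_esymm_weight β hβ, add_comm]
    rfl

theorem lowerEntry_eq (β : Fin M →₀ ℕ) (m : Fin M) :
    lowerEntry β m = ⇑(β - Finsupp.single m 1 : Fin M →₀ ℕ) := by
  funext k
  rw [lowerEntry, Function.update_apply, Finsupp.tsub_apply, Finsupp.single_apply]
  split_ifs with h1 h2 h2
  · rw [h1]
  · exact absurd h1.symm h2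
  · exact absurd h2.symm h1
  · rfl

end Weights

end ColoredEulerian

open ColoredEulerian in
theorem mainTheorem11 (M n : ℕ) (β : Fin M → ℕ) (hβ : ∑ m, β m = n) :
    ColoredEulerian.derangementQSym n β =
      (-1) ^ n * ∏ m, ColoredEulerian.elemSym (β m) +
        ∑ m, if 0 < β m then
          ColoredEulerian.derangementQSym (n - 1) (ColoredEulerian.lowerEntry β m) *
            ColoredEulerian.complSym 1
        else 0 := by
  obtain ⟨β, rfl⟩ := Finsupp.equivFunOnFinite.surjective β
  change ∑ m, β m = n at hβ
  change derangementQSym n β = (-1) ^ n * ∏ m, elemSym (β m) + ∑ m, if 0 < β m then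
    derangementQSym (n - 1) (lowerEntry β m) * complSym 1 else 0
  ext d
  -- The variables occurring in `d` suffice for its coefficient, also in the products on the right,
  -- since divisors of the monomial involve no others.
  rw [agreeOn_derangementQSym (W := d.support) β hβ d subset_rfl, unfixedColoredSum_eq β hβ]
  symm
  refine AgreeOn.add (W := d.support)
    ((AgreeOn.refl _).mul (AgreeOn.prod fun m _ => agreeOn_elemSym _ _))
    (AgreeOn.sum fun m _ => ?_) d subset_rfl
  split_ifs with hm
  · have hsum : ∑ k, (β - Finsupp.single m 1 : Fin M →₀ ℕ) k = n - 1 := by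
      have h := congrArg Finsupp.degree
        (tsub_add_cancel_of_le (Finsupp.single_le_iff.2 (Nat.one_le_iff_ne_zero.2 hm.ne')))
      rw [map_add, Finsupp.degree_single, Finsupp.degree_eq_sum, Finsupp.degree_eq_sum, hβ] at h
      omega
    rw [lowerEntry_eq]
    exact (agreeOn_derangementQSym _ hsum).mul (agreeOn_complSym_one _)
  · exact AgreeOn.refl _
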